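/- Theorem (Solution of the Popoviciu–Ionescu functional equation in one variable). Let $n\ge 0$ be an integer and let $f:\mathbb{R}\to\mathbb{R}$ be a continuous function such that $$\det\bigl[f(x+(i+j)h)\bigr]_{i,j=0}^{n}=0\qquad\text{for all } x,h\in\mathbb{R}.$$ Then $f$ is an exponential polynomial, i.e. there are a finite number $s\ge 0$, complex polynomials $P_1,\dots,P_s$ and complex numbers $\lambda_1,\dots,\lambda_s$ such that $$f(x)=\sum_{k=1}^{s}P_k(x)\,e^{\lambda_k x}\qquad\text{for all } x\in\mathbb{R}.$$ -/

import Mathlib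

/-- A function `g : ℝ → ℂ` is an exponential polynomial (in one variable) if it is a finite sum
`g x = ∑ k, P k (x) * exp (lam k * x)` with complex polynomials `P k` and complex frequencies
`lam k`. (The empty sum gives the zero function.) A real-valued function is an exponential
polynomial if it is one when regarded as a complex-valued function. -/
def IsExponentialPolynomial (g : ℝ → ℂ) : Prop :=
  ∃ (s : ℕ) (P : Fin s → Polynomial ℂ) (lam : Fin s → ℂ),
    ∀ x : ℝ, g x = ∑ k : Fin s, (P k).eval (x : ℂ) * Complex.exp (lam k * (x : ℂ))

/-! On each grid `(1/N)ℤ`, `f` is a sequence whose consecutive Hankel determinants of order `n + 1`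
vanish. Such a sequence obeys one linear recurrence of order at most `n`
(`exists_shiftEval_eq_zero`), so all minors `det a(s i + t j)` of that order vanish. Rounding real
nodes to finer grids and using continuity gives `det f(s i + t j) = 0` for all real nodes. A nonzero
minor of maximal order then gives an addition formula for `f` (`exists_minor_add_eq`), which turns a
matrix of translates into a continuous one-parameter group. Hence `A' = L * A`, and Cayley–Hamilton
splits this into scalar equations `g' = r * g + h`, solvable within exponential polynomials. -/

/-- Evaluation of a polynomial in the shift operator on bi-infinite sequences. -/
noncomputable def shiftEval {K : Type*} [Field K] (a : ℤ → K) (p : Polynomial K) (k : ℤ) : K :=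
  p.sum fun j c => c * a (k + j)

/-! ### Hankel determinants and linear recurrences -/

section Hankel

open Polynomial

variable {K : Type*} [Field K] (a : ℤ → K)

theorem shiftEval_eq_sum_range {N : ℕ} {p : K[X]} (hp : p.natDegree < N) (k : ℤ) :
    shiftEval a p k = ∑ j ∈ Finset.range N, p.coeff j * a (k + j) :=
  Polynomial.sum_over_range' p (by simp) N hp

theorem shiftEval_add (p q : K[X]) (k : ℤ) :
    shiftEval a (p + q) k = shiftEval a p k + shiftEval a q k :=
  Polynomial.sum_add_index p q _ (by simp) (by intros; ring)

@[simp]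
theorem shiftEval_zero (k : ℤ) : shiftEval a 0 k = 0 := by
  simp [shiftEval]

theorem shiftEval_C_mul (c : K) (p : K[X]) (k : ℤ) :
    shiftEval a (C c * p) k = c * shiftEval a p k := by
  have h : (C c * p).natDegree < p.natDegree + 1 :=
    Nat.lt_succ_of_le (natDegree_C_mul_le c p)
  rw [shiftEval_eq_sum_range a h, shiftEval_eq_sum_range a p.natDegree.lt_succ_self,
    Finset.mul_sum]
  exact Finset.sum_congr rfl fun j _ => by rw [coeff_C_mul, mul_assoc]

theorem shiftEval_sub (p q : K[X]) (k : ℤ) :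
    shiftEval a (p - q) k = shiftEval a p k - shiftEval a q k := by
  have h := shiftEval_add a (p - q) q k
  rw [sub_add_cancel] at h
  rw [h, add_sub_cancel_right]

theorem shiftEval_X_mul (p : K[X]) (k : ℤ) :
    shiftEval a (X * p) k = shiftEval a p (k + 1) := by
  have h : (X * p).natDegree < p.natDegree + 2 := by
    have := natDegree_mul_le (p := X) (q := p)
    rw [natDegree_X] at this
    omega
  rw [shiftEval_eq_sum_range a h, shiftEval_eq_sum_range a p.natDegree.lt_succ_self,
    Finset.sum_range_succ']
  simp only [coeff_X_mul, coeff_X_mul_zero, zero_mul, add_zero]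
  refine Finset.sum_congr rfl fun j _ => ?_
  push_cast
  ring_nf

theorem shiftEval_sum {ι : Type*} (s : Finset ι) (p : ι → K[X]) (k : ℤ) :
    shiftEval a (∑ i ∈ s, p i) k = ∑ i ∈ s, shiftEval a (p i) k := by
  classical
  induction s using Finset.induction_on with
  | empty => simp
  | insert i s hi ih => rw [Finset.sum_insert hi, Finset.sum_insert hi, shiftEval_add, ih]

theorem shiftEval_X_pow (m : ℕ) (k : ℤ) : shiftEval a (X ^ m) k = a (k + m) := by
  simp [shiftEval, X_pow_eq_monomial]

theorem shiftEval_mul_eq_zero {p : K[X]} (hp : ∀ k, shiftEval a p k = 0) (q : K[X]) (k : ℤ) :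
    shiftEval a (q * p) k = 0 := by
  induction q using Polynomial.induction_on' generalizing k with
  | add q r hq hr => rw [add_mul, shiftEval_add, hq, hr, add_zero]
  | monomial m c =>
    rw [← C_mul_X_pow_eq_monomial, mul_assoc, shiftEval_C_mul]
    suffices h : ∀ k, shiftEval a (X ^ m * p) k = 0 by rw [h, mul_zero]
    induction m with
    | zero => simpa using hp
    | succ m ih =>
      intro k
      rw [pow_succ', mul_assoc, shiftEval_X_mul, ih]

/-- The Hankel matrix of size `m` at position `k` has a nonzero kernel vector, viewed as a
polynomial. -/
def HankelSingular (m : ℕ) (k : ℤ) : Prop :=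
  ∃ p : K[X], p ≠ 0 ∧ p.degree < m ∧ ∀ i : ℕ, i < m → shiftEval a p (k + i) = 0

variable {a}

theorem eq_zero_of_not_hankelSingular {m : ℕ} {k : ℤ} (h : ¬ HankelSingular a m k) {p : K[X]}
    (hd : p.degree < m) (hp : ∀ i : ℕ, i < m → shiftEval a p (k + i) = 0) : p = 0 := by
  by_contra h0
  exact h ⟨p, h0, hd, hp⟩

theorem hankelSingular_of_det_eq_zero {m : ℕ} {k : ℤ}
    (h : (Matrix.of fun i j : Fin m => a (k + i + j)).det = 0) : HankelSingular a m k := by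
  obtain ⟨v, hv, h0⟩ := Matrix.exists_mulVec_eq_zero_iff.2 h
  refine ⟨((degreeLTEquiv K m).symm v : K[X]), ?_, mem_degreeLT.1 (Subtype.property _), ?_⟩
  · simpa using hv
  · intro i hi
    have hc : ∀ j : Fin m, ((degreeLTEquiv K m).symm v : K[X]).coeff j = v j := fun j =>
      congrFun ((degreeLTEquiv K m).apply_symm_apply v) j
    have hd : ((degreeLTEquiv K m).symm v : K[X]).natDegree < m := by
      by_cases hz : ((degreeLTEquiv K m).symm v : K[X]) = 0
      · rw [hz, natDegree_zero]
        omega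
      · exact (natDegree_lt_iff_degree_lt hz).2 (mem_degreeLT.1 (Subtype.property _))
    rw [shiftEval_eq_sum_range a hd, Finset.sum_range]
    have := congrFun h0 ⟨i, hi⟩
    simp only [Matrix.mulVec, dotProduct, Matrix.of_apply, Pi.zero_apply] at this
    rw [← this]
    exact Finset.sum_congr rfl fun j _ => by rw [hc, mul_comm]

theorem degree_lt_of_coeff_eq_zero {p : K[X]} {n : ℕ} (hd : p.degree < (n + 1 : ℕ))
    (h : p.coeff n = 0) : p.degree < n := by
  rw [degree_lt_iff_coeff_zero] at hd ⊢
  intro j hj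
  rcases hj.eq_or_lt with rfl | hj
  · exact h
  · exact hd j hj

theorem degree_C_mul_le_degree (c : K) (p : K[X]) : (C c * p).degree ≤ p.degree := by
  rw [← smul_eq_C_mul]
  exact degree_smul_le c p

theorem degree_X_mul_lt {p : K[X]} {n : ℕ} :
    (X * p).degree < ((n + 1 : ℕ) : WithBot ℕ) ↔ p.degree < (n : WithBot ℕ) := by
  simp only [degree_lt_iff_coeff_zero]
  constructor
  · intro h j hj
    simpa using h (j + 1) (by omega)
  · rintro h (_ | j) hj
    · omega
    · simpa using h j (by omega)

section Propagation

variable {n : ℕ} {k : ℤ} (hk : ¬ HankelSingular a n k) {p : K[X]} (hp0 : p ≠ 0)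
  (hpd : p.degree < (n + 1 : ℕ)) (hp : ∀ i : ℕ, i < n + 1 → shiftEval a p (k - 1 + i) = 0)

include hk hp0 hpd hp

/-- The nonsingular block at `k` is the centre of the larger one at `k - 1`: if `p = X * q`, then
`q` would be a kernel vector of that centre. -/
theorem coeff_zero_ne_zero_of_window : p.coeff 0 ≠ 0 := by
  intro h
  obtain ⟨q, rfl⟩ := X_dvd_iff.2 h
  refine hp0 ?_
  rw [eq_zero_of_not_hankelSingular hk (degree_X_mul_lt.1 hpd) fun i hi => ?_, mul_zero]
  rw [← hp i (by omega), shiftEval_X_mul]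
  congr 1
  ring

omit hk hp0 hpd in
theorem shiftEval_window (i : ℕ) (hi : i < n) : shiftEval a p (k + i) = 0 := by
  rw [← hp (i + 1) (by omega)]
  congr 1
  push_cast
  ring

theorem coeff_ne_zero_of_window : p.coeff n ≠ 0 := fun h =>
  hp0 (eq_zero_of_not_hankelSingular hk (degree_lt_of_coeff_eq_zero hpd h)
    (shiftEval_window hp))

theorem not_hankelSingular_add_one : ¬ HankelSingular a n (k + 1) := by
  rintro ⟨q, hq0, hqd, hq⟩
  have hn := coeff_ne_zero_of_window hk hp0 hpd hp
  have h0 := coeff_zero_ne_zero_of_window hk hp0 hpd hp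
  -- This multiple of `p` cancels the top coefficient of `X * q`, leaving a kernel vector of the
  -- block at `k`.
  set c := (X * q).coeff n / p.coeff n with hc
  have hr : X * q - C c * p = 0 := by
    refine eq_zero_of_not_hankelSingular hk (degree_lt_of_coeff_eq_zero ?_ ?_) ?_
    · refine (degree_sub_le _ _).trans_lt (max_lt (degree_X_mul_lt.2 hqd) ?_)
      exact (degree_C_mul_le_degree _ _).trans_lt hpd
    · rw [coeff_sub, coeff_C_mul, hc, div_mul_cancel₀ _ hn, sub_self]
    · intro i hi
      rw [shiftEval_sub, shiftEval_C_mul, shiftEval_X_mul, shiftEval_window hp i hi,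
        mul_zero, sub_zero, ← hq i hi]
      congr 1
      ring
  have hc0 : c = 0 := by
    have := congrArg (fun r => coeff r 0) hr
    simpa [h0] using this
  rw [hc0, C_0, zero_mul, sub_zero] at hr
  exact hq0 ((mul_eq_zero.1 hr).resolve_left X_ne_zero)

theorem not_hankelSingular_sub_one : ¬ HankelSingular a n (k - 1) := by
  rintro ⟨q, hq0, hqd, hq⟩
  have hn := coeff_ne_zero_of_window hk hp0 hpd hp
  have h0 := coeff_zero_ne_zero_of_window hk hp0 hpd hp
  -- Mirror image: the constant term is cancelled, then a factor `X` is divided out.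
  set c := q.coeff 0 / p.coeff 0 with hc
  have hX : X ∣ q - C c * p := by
    rw [X_dvd_iff, coeff_sub, coeff_C_mul, hc, div_mul_cancel₀ _ h0, sub_self]
  obtain ⟨r, hr⟩ := hX
  have hr0 : r = 0 := by
    refine eq_zero_of_not_hankelSingular hk (degree_X_mul_lt.1 ?_) ?_
    · rw [← hr]
      refine (degree_sub_le _ _).trans_lt (max_lt (hqd.trans ?_) ?_)
      · exact_mod_cast n.lt_succ_self
      · exact (degree_C_mul_le_degree _ _).trans_lt hpd
    · intro i hi
      have : shiftEval a (X * r) (k - 1 + i) = 0 := by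
        rw [← hr, shiftEval_sub, shiftEval_C_mul, hq i hi, hp i (by omega), mul_zero, sub_zero]
      rw [← this, shiftEval_X_mul]
      congr 1
      ring
  rw [hr0, mul_zero, sub_eq_zero] at hr
  have hc0 : c = 0 := by
    have := congrArg (fun r => coeff r n) hr
    simp only [coeff_C_mul, degree_lt_iff_coeff_zero _ _ |>.1 hqd n le_rfl] at this
    exact (mul_eq_zero.1 this.symm).resolve_right hn
  exact hq0 (by rw [hr, hc0, C_0, zero_mul])

end Propagation

/-- Either the order drops, or one nonsingular block of size `n` forces all of them to be
nonsingular. Then overlapping windows have proportional kernel polynomials, hence a common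
recurrence. -/
theorem exists_shiftEval_eq_zero (n : ℕ) (h : ∀ k, HankelSingular a (n + 1) k) :
    ∃ p : K[X], p ≠ 0 ∧ p.natDegree ≤ n ∧ ∀ k, shiftEval a p k = 0 := by
  induction n with
  | zero =>
    refine ⟨1, one_ne_zero, by simp, fun k => ?_⟩
    obtain ⟨p, hp0, hpd, hp⟩ := h k
    obtain ⟨c, rfl⟩ : ∃ c, p = C c :=
      ⟨_, eq_C_of_degree_le_zero (degree_le_of_natDegree_le
        (Nat.lt_succ_iff.1 ((natDegree_lt_iff_degree_lt hp0).2 hpd)))⟩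
    have hc : c ≠ 0 := by simpa using hp0
    have := hp 0 (by omega)
    rw [← mul_one (C c), shiftEval_C_mul] at this
    simpa [hc] using this
  | succ n ih =>
    by_cases hs : ∀ k, HankelSingular a (n + 1) k
    · obtain ⟨p, hp0, hpd, hp⟩ := ih hs
      exact ⟨p, hp0, by omega, hp⟩
    push Not at hs
    obtain ⟨k₀, hk₀⟩ := hs
    have hns : ∀ k, ¬ HankelSingular a (n + 1) k := by
      intro k
      induction k using Int.inductionOn' (b := k₀) with
      | zero => exact hk₀
      | succ k _ hk =>
        obtain ⟨p, hp0, hpd, hp⟩ := h (k - 1)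
        exact not_hankelSingular_add_one hk hp0 hpd hp
      | pred k _ hk =>
        obtain ⟨p, hp0, hpd, hp⟩ := h (k - 1)
        exact not_hankelSingular_sub_one hk hp0 hpd hp
    choose p hp0 hpd hp using fun k => h (k - 1)
    have hprop : ∀ k, ∃ c : K, c ≠ 0 ∧ p k = C c * p (k + 1) := by
      intro k
      have h1 := coeff_ne_zero_of_window (hns k) (hp0 k) (hpd k) (hp k)
      have h2 := coeff_ne_zero_of_window (hns _) (hp0 (k + 1)) (hpd (k + 1)) (hp (k + 1))
      refine ⟨(p k).coeff (n + 1) / (p (k + 1)).coeff (n + 1), div_ne_zero h1 h2, ?_⟩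
      refine sub_eq_zero.1 (eq_zero_of_not_hankelSingular (hns k)
        (degree_lt_of_coeff_eq_zero ?_ ?_) ?_)
      · refine (degree_sub_le _ _).trans_lt (max_lt (hpd k) ?_)
        exact (degree_C_mul_le_degree _ _).trans_lt (hpd (k + 1))
      · rw [coeff_sub, coeff_C_mul, div_mul_cancel₀ _ h2, sub_self]
      · intro i hi
        have := hp (k + 1) i (by omega)
        rw [add_sub_cancel_right] at this
        rw [shiftEval_sub, shiftEval_C_mul, shiftEval_window (hp k) i hi, this,
          mul_zero, sub_zero]
    have hall : ∀ k, ∃ c : K, p 0 = C c * p k := by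
      intro k
      induction k using Int.induction_on with
      | zero => exact ⟨1, by simp⟩
      | succ k ih =>
        obtain ⟨c, hc⟩ := ih
        obtain ⟨d, -, hd⟩ := hprop k
        exact ⟨c * d, by rw [hc, hd, C_mul, mul_assoc]⟩
      | pred k ih =>
        obtain ⟨c, hc⟩ := ih
        obtain ⟨d, hd0, hd⟩ := hprop (-k - 1)
        rw [sub_add_cancel] at hd
        refine ⟨c * d⁻¹, ?_⟩
        rw [hc, hd, ← mul_assoc, ← C_mul, mul_assoc, inv_mul_cancel₀ hd0, mul_one]
    refine ⟨p 0, hp0 0, ?_, fun k => ?_⟩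
    · have := (natDegree_lt_iff_degree_lt (hp0 0)).2 (hpd 0)
      omega
    · obtain ⟨c, hc⟩ := hall (k + 1)
      have := hp (k + 1) 0 (by omega)
      simp only [Nat.cast_zero, add_zero, add_sub_cancel_right] at this
      rw [hc, shiftEval_C_mul, this, mul_zero]

/-- If all consecutive Hankel determinants of order `n + 1` of a bi-infinite sequence vanish, then
so do all minors of order `n + 1` of its infinite Hankel matrix. -/
theorem det_translates_eq_zero {n : ℕ}
    (h : ∀ k : ℤ, (Matrix.of fun i j : Fin (n + 1) => a (k + i + j)).det = 0)
    (s t : Fin (n + 1) → ℤ) :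
    (Matrix.of fun i j => a (s i + t j)).det = 0 := by
  obtain ⟨p, hp0, hpd, hp⟩ :=
    exists_shiftEval_eq_zero n fun k => hankelSingular_of_det_eq_zero (h k)
  obtain ⟨b, hb⟩ : ∃ b, ∀ i, b ≤ s i :=
    (Set.finite_range s).bddBelow.imp fun b hb i => hb ⟨i, rfl⟩
  obtain ⟨v, hv, hv0⟩ : ∃ v : Fin (n + 1) → K, v ≠ 0 ∧
      p ∣ ∑ i, C (v i) * X ^ (s i - b).toNat := by
    -- These are `n + 1` residues modulo `p` in a space of dimension `n`; the bound `b` keeps the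
    -- exponents natural.
    let r : Fin (n + 1) → degreeLT K n := fun i => ⟨X ^ (s i - b).toNat % p,
      mem_degreeLT.2 ((degree_mod_lt _ hp0).trans_le (natDegree_le_iff_degree_le.1 hpd))⟩
    have hdep : ¬ LinearIndependent K r := by
      intro hli
      have := hli.fintype_card_le_finrank
      rw [(degreeLTEquiv K n).finrank_eq] at this
      simp at this
    obtain ⟨v, hv, i, hi⟩ := Fintype.not_linearIndependent_iff.1 hdep
    refine ⟨v, fun h => hi (congrFun h i), ?_⟩
    have hv' : ∑ i, C (v i) * (X ^ (s i - b).toNat % p) = 0 := by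
      simpa [r, smul_eq_C_mul] using congrArg (Subtype.val) hv
    rw [← sub_zero (∑ i, C (v i) * X ^ (s i - b).toNat), ← hv', ← Finset.sum_sub_distrib]
    refine Finset.dvd_sum fun i _ => ?_
    rw [← mul_sub]
    refine Dvd.dvd.mul_left ⟨X ^ (s i - b).toNat / p, ?_⟩ _
    rw [sub_eq_iff_eq_add, EuclideanDomain.div_add_mod]
  refine Matrix.exists_vecMul_eq_zero_iff.1 ⟨v, hv, funext fun j => ?_⟩
  obtain ⟨q, hq⟩ := hv0
  have := shiftEval_mul_eq_zero a hp q (b + t j)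
  rw [mul_comm, ← hq, shiftEval_sum] at this
  rw [Pi.zero_apply, ← this]
  simp only [Matrix.vecMul, dotProduct, Matrix.of_apply]
  refine Finset.sum_congr rfl fun i _ => ?_
  rw [shiftEval_C_mul, shiftEval_X_pow, Int.toNat_of_nonneg (sub_nonneg.2 (hb i))]
  congr 2
  ring

end Hankel

/-! ### Differentiability of one-parameter groups -/

section OneParameter

open Filter Topology

/-- A continuous one-parameter group in a Banach algebra is differentiable. -/
theorem exists_hasDerivAt_of_map_add {𝔸 : Type*} [NormedRing 𝔸] [NormedAlgebra ℝ 𝔸]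
    [CompleteSpace 𝔸] {A : ℝ → 𝔸} (hA : Continuous A) (h0 : A 0 = 1)
    (hadd : ∀ x y, A (x + y) = A x * A y) :
    ∃ L : 𝔸, ∀ x, HasDerivAt A (L * A x) x := by
  let I : ℝ → 𝔸 := fun x => ∫ t in (0 : ℝ)..x, A t
  have hI : ∀ x, HasDerivAt I (A x) x := fun x =>
    intervalIntegral.integral_hasDerivAt_right (hA.intervalIntegrable _ _)
      hA.stronglyMeasurable.stronglyMeasurableAtFilter hA.continuousAt
  -- The means `δ⁻¹ • I δ` tend to `A 0 = 1`, and the units are open.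
  have hu : ∃ δ : ℝ, IsUnit (I δ) := by
    have h1 : Tendsto (fun δ : ℝ => δ⁻¹ • I δ) (𝓝[≠] 0) (𝓝 1) := by
      have := (hI 0).tendsto_slope_zero
      simpa [I, h0] using this
    have h2 := h1.eventually (Units.isOpen.mem_nhds isUnit_one)
    obtain ⟨δ, hδ, hδ0⟩ := (h2.and self_mem_nhdsWithin).exists
    refine ⟨δ, ?_⟩
    have h3 : IsUnit (algebraMap ℝ 𝔸 δ) := (IsUnit.mk0 δ hδ0).map _
    have := h3.mul hδ
    rwa [← Algebra.smul_def, smul_smul, mul_inv_cancel₀ hδ0, one_smul] at this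
  obtain ⟨δ, u, hu⟩ := hu
  have hAI : ∀ x, A x = (I (x + δ) - I x) * ↑u⁻¹ := by
    intro x
    rw [Units.eq_mul_inv_iff_mul_eq, hu]
    simp only [I]
    rw [intervalIntegral.integral_interval_sub_left (hA.intervalIntegrable _ _)
      (hA.intervalIntegrable _ _), add_comm x δ]
    have h := (ContinuousLinearMap.mul ℝ 𝔸 (A x)).intervalIntegral_comp_comm
      (hA.intervalIntegrable (μ := MeasureTheory.volume) 0 δ)
    simp only [ContinuousLinearMap.mul_apply', ← hadd] at h
    rw [← h, intervalIntegral.integral_comp_add_left (fun t => A t) x, add_zero, add_comm]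
  have hd : HasDerivAt A ((A (0 + δ) - A 0) * ↑u⁻¹) 0 := by
    have h := (((hI (0 + δ)).comp_add_const 0 δ).sub (hI 0)).mul_const (↑u⁻¹ : 𝔸)
    exact h.congr_of_eventuallyEq (Eventually.of_forall hAI)
  refine ⟨(A (0 + δ) - A 0) * ↑u⁻¹, fun x => ?_⟩
  have hd' := (hd.mul_const (A x))
  have h2 : HasDerivAt (fun y => A (y - x) * A x) ((A (0 + δ) - A 0) * ↑u⁻¹ * A x) x := by
    exact HasDerivAt.comp_sub_const x x (by rwa [sub_self])
  refine h2.congr_of_eventuallyEq (Eventually.of_forall fun y => ?_)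
  simp only [← hadd, sub_add_cancel]

end OneParameter

/-! ### Exponential polynomials and linear differential equations -/

namespace IsExponentialPolynomial

open Polynomial

protected theorem zero : IsExponentialPolynomial fun _ => 0 :=
  ⟨0, Fin.elim0, Fin.elim0, by simp⟩

theorem monomial (P : ℂ[X]) (l : ℂ) :
    IsExponentialPolynomial fun x : ℝ => P.eval (x : ℂ) * Complex.exp (l * x) :=
  ⟨1, fun _ => P, fun _ => l, by simp⟩

protected theorem add {g h : ℝ → ℂ} (hg : IsExponentialPolynomial g)
    (hh : IsExponentialPolynomial h) : IsExponentialPolynomial fun x => g x + h x := by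
  obtain ⟨s, P, l, hP⟩ := hg
  obtain ⟨r, Q, m, hQ⟩ := hh
  refine ⟨s + r, Fin.append P Q, Fin.append l m, fun x => ?_⟩
  simp [Fin.sum_univ_add, hP, hQ]

protected theorem sum {ι : Type*} (s : Finset ι) {g : ι → ℝ → ℂ}
    (hg : ∀ i ∈ s, IsExponentialPolynomial (g i)) :
    IsExponentialPolynomial fun x => ∑ i ∈ s, g i x := by
  classical
  induction s using Finset.induction_on with
  | empty => simpa using IsExponentialPolynomial.zero
  | insert i s hi ih =>
    simp only [Finset.sum_insert hi]
    exact (hg i (Finset.mem_insert_self _ _)).add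
      (ih fun j hj => hg j (Finset.mem_insert_of_mem hj))

/-- Antidifferentiation for `c = 0`; otherwise dividing by `c` leaves an error of lower degree. -/
theorem exists_derivative_add_C_mul_eq (c : ℂ) (P : ℂ[X]) :
    ∃ Q : ℂ[X], derivative Q + C c * Q = P := by
  induction P using Polynomial.induction_on' with
  | add P₁ P₂ h₁ h₂ =>
    obtain ⟨Q₁, rfl⟩ := h₁
    obtain ⟨Q₂, rfl⟩ := h₂
    exact ⟨Q₁ + Q₂, by rw [derivative_add]; ring⟩
  | monomial n a =>
    rcases eq_or_ne c 0 with rfl | hc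
    · refine ⟨Polynomial.monomial (n + 1) (a / (n + 1)), ?_⟩
      rw [derivative_monomial]
      have : (n : ℂ) + 1 ≠ 0 := Nat.cast_add_one_ne_zero n
      simp [div_mul_cancel₀ _ this]
    · induction n generalizing a with
      | zero =>
        refine ⟨C (a / c), ?_⟩
        rw [derivative_C, zero_add, ← C_mul, mul_div_cancel₀ _ hc]
        rfl
      | succ n ih =>
        obtain ⟨Q, hQ⟩ := ih (a / c * (n + 1))
        refine ⟨Polynomial.monomial (n + 1) (a / c) - Q, ?_⟩
        rw [derivative_sub, mul_sub, sub_add_sub_comm, hQ, derivative_monomial, C_mul_monomial,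
          mul_div_cancel₀ _ hc]
        simp

theorem hasDerivAt_monomial (Q : ℂ[X]) (m : ℂ) (x : ℝ) :
    HasDerivAt (fun x : ℝ => Q.eval (x : ℂ) * Complex.exp (m * x))
      ((derivative Q + C m * Q).eval (x : ℂ) * Complex.exp (m * x)) x := by
  have h1 : HasDerivAt (fun z : ℂ => Q.eval z * Complex.exp (m * z))
      ((derivative Q).eval (x : ℂ) * Complex.exp (m * x)
        + Q.eval (x : ℂ) * (Complex.exp (m * x) * (m * 1))) (x : ℂ) :=
    (Q.hasDerivAt (x : ℂ)).mul ((hasDerivAt_id (x : ℂ)).const_mul m).cexp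
  refine h1.comp_ofReal.congr_deriv ?_
  simp only [eval_add, eval_mul, eval_C]
  ring

/-- The equation `H' = l * H + h` has an exponential polynomial solution whenever `h` is one. -/
theorem exists_hasDerivAt (l : ℂ) {h : ℝ → ℂ} (hh : IsExponentialPolynomial h) :
    ∃ H : ℝ → ℂ, IsExponentialPolynomial H ∧ ∀ x, HasDerivAt H (l * H x + h x) x := by
  obtain ⟨s, P, m, hP⟩ := hh
  choose Q hQ using fun k => exists_derivative_add_C_mul_eq (m k - l) (P k)
  refine ⟨fun x => ∑ k, (Q k).eval (x : ℂ) * Complex.exp (m k * x),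
    .sum _ fun k _ => monomial (Q k) (m k), fun x => ?_⟩
  have := HasDerivAt.fun_sum (u := Finset.univ) fun k _ => hasDerivAt_monomial (Q k) (m k) x
  refine this.congr_deriv ?_
  rw [hP, Finset.mul_sum, ← Finset.sum_add_distrib]
  refine Finset.sum_congr rfl fun k _ => ?_
  rw [← hQ]
  simp only [eval_add, eval_mul, eval_C]
  ring

/-- Every solution of `g' = l * g + h` is an exponential polynomial if `h` is one. -/
theorem of_hasDerivAt {l : ℂ} {g h : ℝ → ℂ} (hh : IsExponentialPolynomial h)
    (hg : ∀ x, HasDerivAt g (l * g x + h x) x) : IsExponentialPolynomial g := by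
  obtain ⟨H, hH, hHd⟩ := exists_hasDerivAt l hh
  have hconst : ∀ x : ℝ, (g x - H x) * Complex.exp (-l * x) = g 0 - H 0 := by
    have hd : ∀ x : ℝ, HasDerivAt (fun x : ℝ => (g x - H x) * Complex.exp (-l * x)) 0 x := by
      intro x
      have h1 := hasDerivAt_monomial 1 (-l) x
      simp only [eval_one, one_mul] at h1
      refine (((hg x).sub (hHd x)).mul h1).congr_deriv ?_
      simp
      ring
    intro x
    have := is_const_of_deriv_eq_zero (fun x => (hd x).differentiableAt)
      (fun x => (hd x).deriv) x 0
    simpa using this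
  have hgx : g = fun x : ℝ => H x + (C (g 0 - H 0)).eval (x : ℂ) * Complex.exp (l * x) := by
    funext x
    rw [eval_C, ← hconst x, mul_assoc, ← Complex.exp_add]
    simp
  rw [hgx]
  exact hH.add (monomial _ _)

/-- Functionals of a solution of `φ' = L φ` are exponential polynomials if `L` is algebraic. -/
theorem of_hasDerivAt_mul {𝔸 : Type*} [NormedRing 𝔸] [NormedAlgebra ℂ 𝔸] {L : 𝔸}
    {φ : ℝ → 𝔸} (hφ : ∀ x, HasDerivAt φ (L * φ x) x) {p : ℂ[X]} (hp0 : p ≠ 0)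
    (hp : aeval L p = 0) (F : 𝔸 →L[ℂ] ℂ) : IsExponentialPolynomial fun x => F (φ x) := by
  -- Stated for all `φ`, since peeling off a root `r` replaces `φ` by `(L - r) * φ`.
  have key : ∀ (S : Multiset ℂ) (φ : ℝ → 𝔸), (∀ x, HasDerivAt φ (L * φ x) x) →
      (∀ x, aeval L (S.map fun r => X - C r).prod * φ x = 0) →
      IsExponentialPolynomial fun x => F (φ x) := by
    intro S
    induction S using Multiset.induction_on with
    | empty =>
      intro φ _ h
      have : φ = 0 := funext fun x => by simpa using h x
      simpa [this] using IsExponentialPolynomial.zero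
    | cons r S ih =>
      intro φ hφ h
      have hψ : IsExponentialPolynomial fun x => F ((L - algebraMap ℂ 𝔸 r) * φ x) := by
        refine ih _ (fun x => ?_) (fun x => ?_)
        · refine ((hφ x).const_mul (L - algebraMap ℂ 𝔸 r)).congr_deriv ?_
          rw [← mul_assoc, ← mul_assoc, mul_sub, sub_mul L, Algebra.commutes]
        · rw [← h x, Multiset.map_cons, Multiset.prod_cons, mul_comm (X - C r), map_mul, mul_assoc]
          simp
      refine of_hasDerivAt (l := r) hψ fun x => ?_
      have h1 := (F.restrictScalars ℝ).hasFDerivAt.comp_hasDerivAt x (hφ x)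
      refine h1.congr_deriv ?_
      simp [sub_mul, ← Algebra.smul_def]
  refine key p.roots φ hφ fun x => ?_
  have h1 := (IsAlgClosed.splits p).eq_prod_roots
  rw [h1, map_mul, aeval_C] at hp
  have hl : IsUnit (algebraMap ℂ 𝔸 p.leadingCoeff) :=
    (IsUnit.mk0 _ (leadingCoeff_ne_zero.2 hp0)).map _
  rw [(hl.mul_right_eq_zero).1 hp, zero_mul]

end IsExponentialPolynomial

/-! ### Vanishing minors and the addition formula -/

section Minors

open Filter Topology

theorem tendsto_floor_mul_div_natCast (x : ℝ) :
    Tendsto (fun N : ℕ => (⌊x * N⌋ : ℝ) / N) atTop (𝓝 x) := by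
  have h : Tendsto (fun N : ℕ => x - 1 / (N : ℝ)) atTop (𝓝 x) := by
    simpa using tendsto_const_nhds.sub (tendsto_const_div_atTop_nhds_zero_nat (1 : ℝ))
  refine tendsto_of_tendsto_of_tendsto_of_le_of_le' h tendsto_const_nhds ?_ ?_ <;>
    filter_upwards [eventually_gt_atTop 0] with N hN
  · have hN' : (0 : ℝ) < N := Nat.cast_pos.2 hN
    rw [le_div_iff₀ hN', sub_mul, one_div, inv_mul_cancel₀ hN'.ne']
    exact (Int.sub_one_lt_floor _).le
  · rw [div_le_iff₀ (Nat.cast_pos.2 hN)]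
    exact Int.floor_le _

theorem det_translates_eq_zero_of_continuous {n : ℕ} {f : ℝ → ℝ} (hf : Continuous f)
    (hdet : ∀ x h : ℝ,
      (Matrix.of fun i j : Fin (n + 1) =>
        f (x + (((i : ℕ) + (j : ℕ) : ℕ) : ℝ) * h)).det = 0)
    (s t : Fin (n + 1) → ℝ) : (Matrix.of fun i j => f (s i + t j)).det = 0 := by
  have hz : ∀ N : ℕ,
      (Matrix.of fun i j => f ((⌊s i * N⌋ : ℝ) / N + (⌊t j * N⌋ : ℝ) / N)).det = 0 := by
    intro N
    have := det_translates_eq_zero (a := fun k : ℤ => f (k / N)) (n := n) (fun k => ?_)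
      (fun i => ⌊s i * N⌋) (fun j => ⌊t j * N⌋)
    · simpa only [Int.cast_add, add_div] using this
    · rw [← hdet (k / N) (1 / N)]
      congr 2
      funext i j
      push_cast
      congr 1
      ring
  have hlim : Tendsto (fun N : ℕ =>
      (Matrix.of fun i j => f ((⌊s i * N⌋ : ℝ) / N + (⌊t j * N⌋ : ℝ) / N)).det) atTop
      (𝓝 (Matrix.of fun i j => f (s i + t j)).det) := by
    refine (continuous_id.matrix_det.tendsto _).comp
      (tendsto_pi_nhds.2 fun i => tendsto_pi_nhds.2 fun j => ?_)
    exact (hf.tendsto _).comp ((tendsto_floor_mul_div_natCast _).add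
      (tendsto_floor_mul_div_natCast _))
  simp only [hz] at hlim
  exact (tendsto_nhds_unique hlim tendsto_const_nhds)

/-- A function all of whose translation minors of some order vanish splits through a maximal
nonzero minor. -/
theorem exists_minor_add_eq {G K : Type*} [Add G] [Field K] {n : ℕ} {g : G → K}
    (h : ∀ s t : Fin (n + 1) → G, (Matrix.of fun i j => g (s i + t j)).det = 0) :
    ∃ (m : ℕ) (s t : Fin m → G), IsUnit (Matrix.of fun i j => g (s i + t j)).det ∧
      ∀ x y, g (x + y) = (fun j => g (x + t j)) ⬝ᵥ
        ((Matrix.of fun i j => g (s i + t j))⁻¹.mulVec fun i => g (s i + y)) := by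
  classical
  let Q : ℕ → Prop := fun m => ∀ s t : Fin m → G, (Matrix.of fun i j => g (s i + t j)).det = 0
  have hQ : ∃ m, Q m := ⟨_, h⟩
  -- The empty minor is `1`, so the least vanishing order is positive.
  obtain ⟨m, hm⟩ : ∃ m, Nat.find hQ = m + 1 := by
    refine Nat.exists_eq_succ_of_ne_zero fun h0 => ?_
    have := Nat.find_spec hQ
    rw [h0] at this
    simpa using this Fin.elim0 Fin.elim0
  have h1 : Q (m + 1) := hm ▸ Nat.find_spec hQ
  have h2 : ¬ Q m := Nat.find_min hQ (by omega)
  simp only [Q, not_forall] at h2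
  obtain ⟨s, t, hst⟩ := h2
  have hu : IsUnit (Matrix.of fun i j => g (s i + t j)).det := isUnit_iff_ne_zero.2 hst
  refine ⟨m, s, t, hu, fun x y => ?_⟩
  set Φ : Matrix (Fin m) (Fin m) K := Matrix.of fun i j => g (s i + t j) with hΦ
  let _ := Φ.invertibleOfIsUnitDet hu
  have h3 := h1 (Sum.elim s (fun _ : Fin 1 => x) ∘ finSumFinEquiv.symm)
    (Sum.elim t (fun _ : Fin 1 => y) ∘ finSumFinEquiv.symm)
  -- `Φ` is bordered by row `x` and column `y`; the Schur complement must vanish.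
  have h4 := Matrix.det_fromBlocks₁₁ Φ (Matrix.of fun i (_ : Fin 1) => g (s i + y))
    (Matrix.of fun (_ : Fin 1) j => g (x + t j)) (Matrix.of fun _ _ => g (x + y))
  rw [← Matrix.det_submatrix_equiv_self finSumFinEquiv.symm] at h4
  have h5 : (Matrix.fromBlocks Φ (Matrix.of fun i (_ : Fin 1) => g (s i + y))
      (Matrix.of fun (_ : Fin 1) j => g (x + t j))
      (Matrix.of fun _ _ => g (x + y))).submatrix finSumFinEquiv.symm finSumFinEquiv.symm =
      Matrix.of fun i j => g ((Sum.elim s (fun _ : Fin 1 => x) ∘ finSumFinEquiv.symm) i +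
        (Sum.elim t (fun _ : Fin 1 => y) ∘ finSumFinEquiv.symm) j) := by
    ext i j
    simp only [Matrix.submatrix_apply, Matrix.of_apply, Function.comp_apply]
    rcases finSumFinEquiv.symm i with i | i <;> rcases finSumFinEquiv.symm j with j | j <;>
      simp [hΦ]
  rw [h5, h3] at h4
  have h6 := (mul_eq_zero.1 h4.symm).resolve_left hst
  rw [Matrix.det_fin_one, Matrix.sub_apply, sub_eq_zero, Matrix.invOf_eq_nonsing_inv,
    Matrix.mul_assoc] at h6
  exact h6

attribute [local instance] Matrix.linftyOpNormedRing Matrix.linftyOpNormedAlgebra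

theorem isExponentialPolynomial_of_det_translates_eq_zero {n : ℕ} {g : ℝ → ℂ} (hg : Continuous g)
    (h : ∀ s t : Fin (n + 1) → ℝ, (Matrix.of fun i j => g (s i + t j)).det = 0) :
    IsExponentialPolynomial g := by
  obtain ⟨m, s, t, hu, hadd⟩ := exists_minor_add_eq h
  set Φ : Matrix (Fin m) (Fin m) ℂ := Matrix.of fun i j => g (s i + t j) with hΦ
  let B : ℝ → Matrix (Fin m) (Fin m) ℂ := fun x => Matrix.of fun i j => g (s i + x + t j)
  have hB0 : B 0 = Φ := by simp [B, hΦ]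
  have hB : ∀ x y, B (x + y) = B x * Φ⁻¹ * B y := by
    intro x y
    ext i j
    have := hadd (s i + x) (y + t j)
    rw [Matrix.mul_assoc]
    simp only [← add_assoc] at this
    refine Eq.trans ?_ this
    simp only [B, Matrix.of_apply, ← add_assoc]
  let A : ℝ → Matrix (Fin m) (Fin m) ℂ := fun x => B x * Φ⁻¹
  have hBc : Continuous B := continuous_matrix fun i j => by
    simp only [B, Matrix.of_apply]
    fun_prop
  have hA : Continuous A := hBc.matrix_mul continuous_const
  have hA0 : A 0 = 1 := by
    simp only [A, hB0]
    exact Matrix.mul_nonsing_inv _ hu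
  have : CompleteSpace (Matrix (Fin m) (Fin m) ℂ) := FiniteDimensional.complete ℂ _
  obtain ⟨L, hL⟩ := exists_hasDerivAt_of_map_add hA hA0 fun x y => by
    simp only [A, hB, Matrix.mul_assoc]
  -- Applying the addition formula twice, at `0 + x` and at `(s i + x) + 0`, gives `g x = F (A x)`.
  let F : Matrix (Fin m) (Fin m) ℂ →ₗ[ℂ] ℂ :=
    { toFun := fun M => (fun j => g (0 + t j)) ⬝ᵥ (Φ⁻¹.mulVec (M.mulVec fun i => g (s i + 0)))
      map_add' := fun M N => by rw [Matrix.add_mulVec, Matrix.mulVec_add, dotProduct_add]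
      map_smul' := fun c M => by
        rw [Matrix.smul_mulVec, Matrix.mulVec_smul, dotProduct_smul]
        rfl }
  have hF := IsExponentialPolynomial.of_hasDerivAt_mul hL (L.charpoly_monic.ne_zero)
    (Matrix.aeval_self_charpoly L) (LinearMap.toContinuousLinearMap F)
  convert hF with x
  have h1 := hadd 0 x
  rw [zero_add] at h1
  rw [h1]
  change _ = (fun j => g (0 + t j)) ⬝ᵥ (Φ⁻¹.mulVec ((A x).mulVec fun i => g (s i + 0)))
  congr 2
  funext i
  have h2 := hadd (s i + x) 0
  rw [add_zero] at h2
  rw [h2]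
  simp only [A, ← Matrix.mulVec_mulVec]
  rfl

end Minors

theorem mainTheorem4 (n : ℕ) (f : ℝ → ℝ) (hf : Continuous f)
    (hdet : ∀ x h : ℝ,
      (Matrix.of fun i j : Fin (n + 1) =>
        f (x + (((i : ℕ) + (j : ℕ) : ℕ) : ℝ) * h)).det = 0) :
    IsExponentialPolynomial (fun x : ℝ => (f x : ℂ)) := by
  refine isExponentialPolynomial_of_det_translates_eq_zero (n := n)
    (Complex.continuous_ofReal.comp hf) fun s t => ?_
  have h := congrArg Complex.ofRealHom (det_translates_eq_zero_of_continuous hf hdet s t)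
  rw [RingHom.map_det, map_zero] at h
  exact h
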